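/- Let $(V,Y,\mathbf 1)$ be a nonzero vertex algebra over $\mathbb{C}$, $Y(v,x)=\sum_{n\in\mathbb{Z}}v_nx^{-n-1}$, with a $\mathbb{C}$-grading $V=\bigoplus_{\lambda\in\mathbb{C}}V_\lambda$ such that $\mathbf 1\in V_0$ and $v_nV_\lambda\subseteq V_{\lambda+\gamma-n-1}$ for $v\in V_\gamma$, $n\in\mathbb{Z}$; write $|v|=\gamma$ for $v\in V_\gamma$. Let $$\Omega(V)=\{v\in V:\ \text{for all } \gamma\in\mathbb{C},\ u\in V_\gamma,\ n\in\mathbb{Z},\ \text{if } u_nv\neq0 \text{ then } n=\gamma-1 \text{ or } n<\mathrm{Re}(\gamma)-1\}.$$ Assume that $V$ is a finitely $\Omega$-generated $\mathbb{C}_{\mathrm{Re}>0}$-graded vertex algebra with strong generators $u^1,\dots,u^k$, that is: (a) $V$ is spanned by the vectors $v^m_{n_m}\cdots v^1_{n_1}w$ with $m\ge 0$, $v^j\in V$, $n_j\in\mathbb{Z}$, $w\in\Omega(V)$; (b) the degree is well defined: $V=\bigoplus_{d\in\mathbb{C}}V(d)$, where $V(d)$ is the span of the vectors $v^m_{n_m}\cdots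 v^1_{n_1}w$ with $m\ge 0$, all $v^j$ homogeneous, $n_j\in\mathbb{Z}$, $w\in\Omega(V)$ and $\sum_j(|v^j|-n_j-1)=d$; (c) $V$ is spanned by the vectors $u^{j_m}_{-n_m}\cdots u^{j_1}_{-n_1}\mathbf 1$ with $m\ge0$, $1\le j_i\le k$ and all $n_i\ge1$; (d) $\dim\Omega(V)<\infty$. For $\lambda\in\mathbb{C}$ put $r(\lambda)=\lambda-\lceil\mathrm{Re}\,\lambda\rceil$, and let $V^0$ be the span of the homogeneous vectors whose weight $\lambda$ has $r(\lambda)=0$, i.e. is an integer. Define bilinear products on $V$ as the linear extensions of the following formulas for $u\in V_\lambda$, $v\in V$, with $\delta=1$ if $r(\lambda)=0$ and $\delta=0$ otherwise: $$u\circ v=\mathrm{Res}_z\frac{(1+z)^{\lceil\mathrm{Re}\,\lambda\rceil+\delta-1}}{z^{1+\delta}}Y(u,z)v,\qquad u*v=\delta\,\mathrm{Res}_z\frac{(1+z)^{\lceil \mathrm{Re}\,\lambda\rceil}}{z}Y(u,z)v .$$ Let $O(V)$ be the span of all $u\circ v$ with $u,v\in V$, and let $A(V)=V/O(V)$ be the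 Zhu algebra, with the product induced by $*$. Assume moreover that (1) every $u^j$ is homogeneous and its weight $|u^j|$ is not an integer; (2) $V^0=\bigoplus_{n=0}^{\infty}V_n$. Then $*$ makes $A(V)$ an associative algebra with unit $\mathbf 1+O(V)$, $\dim A(V)=1$, and $A(V)\cong\mathbb{C}$ as $\mathbb{C}$-algebras. -/

import Mathlib

noncomputable section

/-- A vertex algebra over `ℂ`. The vertex operator map is `Y(u,x) = ∑ u_n x^{-n-1}`; that
`Y(u,x)v` has finitely many negative powers of `x` is part of Mathlib's `VertexOperator`, and
`VertexOperator.ncoeff (Y u) n` is the mode `u_n`. -/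
structure VertexAlgebra (V : Type*) [AddCommGroup V] [Module ℂ V] where
  /-- the vertex operator map -/
  Y : V →ₗ[ℂ] VertexOperator ℂ V
  /-- the vacuum vector -/
  vac : V
  /-- `Y(𝟏,x) = id` -/
  vacuum : ∀ (n : ℤ) (v : V), VertexOperator.ncoeff (Y vac) n v = if n = -1 then v else 0
  /-- `Y(v,x)𝟏` has no negative powers of `x` -/
  creation_regular : ∀ (v : V) (n : ℤ), 0 ≤ n → VertexOperator.ncoeff (Y v) n vac = 0
  /-- the constant term of `Y(v,x)𝟏` is `v` -/
  creation : ∀ v : V, VertexOperator.ncoeff (Y v) (-1) vac = v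
  /-- The Jacobi identity, applied to `w`: the equality of the coefficients of
  `x₀^{-l-1} x₁^{-m-1} x₂^{-n-1}` on both sides. All the sums have finitely many nonzero terms. -/
  jacobi : ∀ (u v w : V) (l m n : ℤ),
    ∑ᶠ i : ℕ, Ring.choose m i •
        VertexOperator.ncoeff (Y (VertexOperator.ncoeff (Y u) (l + i) v)) (m + n - i) w =
      ∑ᶠ i : ℕ, ((-1 : ℤ) ^ i * Ring.choose l i) •
        (VertexOperator.ncoeff (Y u) (m + l - i) (VertexOperator.ncoeff (Y v) (n + i) w) -
          (-1 : ℂ) ^ l •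
            VertexOperator.ncoeff (Y v) (n + l - i) (VertexOperator.ncoeff (Y u) (m + i) w))

namespace VertexAlgebra

variable {V : Type*} [AddCommGroup V] [Module ℂ V] (𝒱 : VertexAlgebra V)

/-- The mode `u_n`. -/
def mode (u : V) (n : ℤ) : Module.End ℂ V := VertexOperator.ncoeff (𝒱.Y u) n

/-- `v^k_{n_k} ⋯ v^1_{n_1} w` for the list `[(v^k, n_k), …, (v^1, n_1)]`. -/
def applyModes (l : List (V × ℤ)) (w : V) : V :=
  l.foldr (fun p x => 𝒱.mode p.1 p.2 x) w

/-- `S` strongly generates `V`: every vector is a finite sum of vectors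
`v^k_{-n_k} ⋯ v^1_{-n_1} 𝟏` with `v^j ∈ S` and all `n_j ≥ 1`. -/
def StronglyGenerates (S : Set V) : Prop :=
  Submodule.span ℂ {x : V | ∃ l : List (V × ℤ),
    (∀ p ∈ l, p.1 ∈ S ∧ p.2 < 0) ∧ x = 𝒱.applyModes l 𝒱.vac} = ⊤

theorem mode_add_left (u u' : V) (n : ℤ) (v : V) :
    𝒱.mode (u + u') n v = 𝒱.mode u n v + 𝒱.mode u' n v := by
  simp [mode]

theorem mode_smul_left (a : ℂ) (u : V) (n : ℤ) (v : V) :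
    𝒱.mode (a • u) n v = a • 𝒱.mode u n v := by
  simp [mode]

/-- Lower truncation, in terms of modes. -/
theorem exists_mode_eq_zero (u v : V) : ∃ N : ℤ, ∀ n, N ≤ n → 𝒱.mode u n v = 0 := by
  refine ⟨-HahnSeries.order ((HahnModule.of ℂ).symm (𝒱.Y u v)), fun n hn => ?_⟩
  exact VertexOperator.ncoeff_eq_zero_of_lt_order _ _ _ (by omega)

theorem finite_support_residue (c m : ℤ) (u v : V) :
    (Function.support fun i : ℕ => Ring.choose c i • 𝒱.mode u (m + i) v).Finite := by
  obtain ⟨N, hN⟩ := 𝒱.exists_mode_eq_zero u v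
  refine (Set.finite_lt_nat (N - m).toNat).subset fun i hi => ?_
  by_contra h
  exact hi (by
    have h : ¬ i < (N - m).toNat := h
    simp only [hN (m + i) (by omega), smul_zero])

/-- `Res_z (1+z)^c z^m Y(u,z)v = ∑_{i ≥ 0} (c choose i) u_{m+i} v`, as a bilinear map. -/
def residue (c m : ℤ) : V →ₗ[ℂ] V →ₗ[ℂ] V :=
  LinearMap.mk₂ ℂ (fun u v => ∑ᶠ i : ℕ, Ring.choose c i • 𝒱.mode u (m + i) v)
    (fun u u' v => by
      rw [← finsum_add_distrib (𝒱.finite_support_residue c m u v)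
        (𝒱.finite_support_residue c m u' v)]
      simp only [mode_add_left, smul_add])
    (fun a u v => by
      rw [smul_finsum' a (𝒱.finite_support_residue c m u v)]
      simp only [mode_smul_left, smul_comm a])
    (fun u v v' => by
      rw [← finsum_add_distrib (𝒱.finite_support_residue c m u v)
        (𝒱.finite_support_residue c m u v')]
      simp only [map_add, smul_add])
    (fun a u v => by
      rw [smul_finsum' a (𝒱.finite_support_residue c m u v)]
      simp only [map_smul, smul_comm a])

end VertexAlgebra

/-- A `ℂ`-graded vertex algebra `V = ⨁_{λ ∈ ℂ} V_λ`. -/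
structure CGradedVertexAlgebra (V : Type*) [AddCommGroup V] [Module ℂ V] extends
    VertexAlgebra V where
  /-- the weight space `V_λ` -/
  wt : ℂ → Submodule ℂ V
  isInternal : DirectSum.IsInternal wt
  vac_mem : vac ∈ wt 0
  mode_mem : ∀ (γ lam : ℂ) (n : ℤ) (u v : V), u ∈ wt γ → v ∈ wt lam →
    toVertexAlgebra.mode u n v ∈ wt (lam + γ - n - 1)

namespace CGradedVertexAlgebra

variable {V : Type*} [AddCommGroup V] [Module ℂ V] (𝒱 : CGradedVertexAlgebra V)

/-- `Ω(V)`: the vectors `v` such that, for every `u ∈ V_γ` and `n ∈ ℤ` with `u_n v ≠ 0`, either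
`n = γ - 1` or `n < Re γ - 1`. -/
def Omega : Submodule ℂ V where
  carrier := {v | ∀ (γ : ℂ) (u : V) (n : ℤ), u ∈ 𝒱.wt γ → 𝒱.mode u n v ≠ 0 →
    (n : ℂ) = γ - 1 ∨ (n : ℝ) < γ.re - 1}
  zero_mem' := fun γ u n _ h => absurd (map_zero _) h
  add_mem' := fun {v w} hv hw γ u n hu h => by
    by_cases h0 : 𝒱.mode u n v = 0
    · refine hw γ u n hu fun h1 => h ?_
      rw [map_add, h0, h1, add_zero]
    · exact hv γ u n hu h0
  smul_mem' := fun a v hv γ u n hu h => hv γ u n hu fun h0 => h (by rw [map_smul, h0, smul_zero])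

/-- `V` is `Ω`-generated: every vector is a finite sum of vectors `v^k_{n_k} ⋯ v^1_{n_1} u^0` with
`v^j ∈ V`, `n_j ∈ ℤ` and `u^0 ∈ Ω(V)`. -/
def IsOmegaGenerated : Prop :=
  Submodule.span ℂ {x : V | ∃ l : List (V × ℤ), ∃ w ∈ 𝒱.Omega, x = 𝒱.applyModes l w} = ⊤

/-- `V(d)`: the span of the vectors `v^k_{n_k} ⋯ v^1_{n_1} u^0` with `u^0 ∈ Ω(V)`, every `v^j`
homogeneous of weight `|v^j|`, and `∑_j (|v^j| - n_j - 1) = d`. The entries of the list are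
`((v^j, n_j), |v^j|)`. -/
def degreeSpace (d : ℂ) : Submodule ℂ V :=
  Submodule.span ℂ {x : V | ∃ l : List ((V × ℤ) × ℂ), ∃ w ∈ 𝒱.Omega,
    (∀ p ∈ l, p.1.1 ∈ 𝒱.wt p.2) ∧ (l.map fun p => p.2 - (p.1.2 : ℂ) - 1).sum = d ∧
      x = 𝒱.applyModes (l.map Prod.fst) w}

/-- An `Ω`-generated `ℂ_{Re>0}`-graded vertex algebra: `V` is `Ω`-generated and the degree, which is
`0` on `Ω(V)` and `∑_j (|v^j| - n_j - 1)` on `v^k_{n_k} ⋯ v^1_{n_1} u^0`, extended linearly, is well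
defined, that is, `V` is the direct sum of the spaces `V(d)`. -/
structure IsOmegaGeneratedRePos : Prop where
  omega_generated : 𝒱.IsOmegaGenerated
  degree_wellDefined : DirectSum.IsInternal 𝒱.degreeSpace

/-- A finitely `Ω`-generated `ℂ_{Re>0}`-graded vertex algebra, with the finite set `S` of strong
generators. -/
structure IsFinitelyOmegaGeneratedRePos (S : Set V) : Prop extends 𝒱.IsOmegaGeneratedRePos where
  finite : S.Finite
  strongly_generates : 𝒱.StronglyGenerates S
  finiteDimensional_omega : FiniteDimensional ℂ 𝒱.Omega

/-- `V^r`: the span of the homogeneous vectors `v` with `|v| - ⌈Re |v|⌉ = r`. -/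
def fracPart (r : ℂ) : Submodule ℂ V :=
  Submodule.span ℂ {v : V | ∃ lam : ℂ, v ∈ 𝒱.wt lam ∧ r = lam - (⌈lam.re⌉ : ℂ)}

/-- `δ_{r,0}` for `r = lam - ⌈Re lam⌉`. -/
def delta (lam : ℂ) : ℤ := if lam - (⌈lam.re⌉ : ℂ) = 0 then 1 else 0

/-- The decomposition `V ≃ ⨁_λ V_λ`. -/
def weightEquiv : DirectSum ℂ (fun lam => 𝒱.wt lam) ≃ₗ[ℂ] V :=
  LinearEquiv.ofBijective (DirectSum.coeLinearMap 𝒱.wt)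
    (show Function.Bijective (DirectSum.coeLinearMap 𝒱.wt) from 𝒱.isInternal)

/-- The bilinear extension of a family of bilinear products `V_λ × V → V`, each given as the
restriction of a bilinear map `V × V → V`. -/
def extend (f : ℂ → V →ₗ[ℂ] V →ₗ[ℂ] V) : V →ₗ[ℂ] V →ₗ[ℂ] V :=
  DirectSum.toModule ℂ ℂ (V →ₗ[ℂ] V) (fun lam => (f lam).comp (𝒱.wt lam).subtype) ∘ₗ
    𝒱.weightEquiv.symm.toLinearMap

theorem extend_of_mem (f : ℂ → V →ₗ[ℂ] V →ₗ[ℂ] V) {lam : ℂ} {u : V} (hu : u ∈ 𝒱.wt lam) :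
    𝒱.extend f u = f lam u := by
  have h : 𝒱.weightEquiv.symm u =
      DirectSum.lof ℂ ℂ (fun i => 𝒱.wt i) lam ⟨u, hu⟩ := by
    rw [LinearEquiv.symm_apply_eq]
    simp [weightEquiv]
  simp [extend, h]

/-- `u ∘ v`, the linear extension of
`Res_z (1+z)^{⌈Re |u|⌉ + δ_{r,0} - 1} z^{-1-δ_{r,0}} Y(u,z)v` for `u ∈ V^r` homogeneous. -/
def circ : V →ₗ[ℂ] V →ₗ[ℂ] V :=
  𝒱.extend fun lam => 𝒱.residue (⌈lam.re⌉ + delta lam - 1) (-1 - delta lam)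

/-- `u * v`, the linear extension of `δ_{r,0} Res_z (1+z)^{|u|} z^{-1} Y(u,z)v` for `u ∈ V^r`
homogeneous; where `δ_{r,0} ≠ 0`, the weight `|u|` is the integer `⌈Re |u|⌉`. -/
def star : V →ₗ[ℂ] V →ₗ[ℂ] V :=
  𝒱.extend fun lam => delta lam • 𝒱.residue ⌈lam.re⌉ (-1)

/-- `O(V)`: the span of all `u ∘ v`. -/
def zhuO : Submodule ℂ V :=
  Submodule.span ℂ {x : V | ∃ u v : V, x = 𝒱.circ u v}

/-- `V / O(V)` is an associative unital algebra under the product induced by `*`, with unit the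
class of `𝟏`. -/
structure ZhuLaws : Prop where
  star_mem_left : ∀ u v : V, u ∈ 𝒱.zhuO → 𝒱.star u v ∈ 𝒱.zhuO
  star_mem_right : ∀ u v : V, v ∈ 𝒱.zhuO → 𝒱.star u v ∈ 𝒱.zhuO
  assoc : ∀ u v w : V, 𝒱.star (𝒱.star u v) w - 𝒱.star u (𝒱.star v w) ∈ 𝒱.zhuO
  vac_star : ∀ u : V, 𝒱.star 𝒱.vac u - u ∈ 𝒱.zhuO
  star_vac : ∀ u : V, 𝒱.star u 𝒱.vac - u ∈ 𝒱.zhuO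

/-- The Zhu algebra `A(V) = V / O(V)`. The proof `h` that `*` induces an associative algebra
structure is used only in the multiplication below. -/
def ZhuAlgebra (_h : 𝒱.ZhuLaws) : Type _ := V ⧸ 𝒱.zhuO

namespace ZhuAlgebra

variable {𝒱} (h : 𝒱.ZhuLaws)

instance : AddCommGroup (𝒱.ZhuAlgebra h) := inferInstanceAs (AddCommGroup (V ⧸ 𝒱.zhuO))

/-- The quotient vector space structure. -/
@[reducible]
def quotientModule : Module ℂ (𝒱.ZhuAlgebra h) := inferInstanceAs (Module ℂ (V ⧸ 𝒱.zhuO))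

/-- The class `[u] = u + O(V)`. -/
def mk (u : V) : 𝒱.ZhuAlgebra h := Submodule.Quotient.mk (p := 𝒱.zhuO) u

/-- The product `[u][v] = [u * v]`. -/
def mul (a b : 𝒱.ZhuAlgebra h) : 𝒱.ZhuAlgebra h :=
  Quotient.map₂ (fun u v => 𝒱.star u v) (by
    intro u u' hu v v' hv
    replace hu : u - u' ∈ 𝒱.zhuO := (Submodule.quotientRel_def _).1 hu
    replace hv : v - v' ∈ 𝒱.zhuO := (Submodule.quotientRel_def _).1 hv
    refine (Submodule.quotientRel_def _).2 ?_
    have e : 𝒱.star u v - 𝒱.star u' v' = 𝒱.star (u - u') v + 𝒱.star u' (v - v') := by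
      simp
    rw [e]
    exact add_mem (h.star_mem_left _ _ hu) (h.star_mem_right _ _ hv)) a b

instance : Ring (𝒱.ZhuAlgebra h) :=
  { (inferInstance : AddCommGroup (𝒱.ZhuAlgebra h)) with
    mul := mul h
    one := mk h 𝒱.vac
    left_distrib := by
      rintro ⟨u⟩ ⟨v⟩ ⟨w⟩
      exact congrArg (mk h) (map_add (𝒱.star u) v w)
    right_distrib := by
      rintro ⟨u⟩ ⟨v⟩ ⟨w⟩
      exact congrArg (mk h) (LinearMap.map_add₂ 𝒱.star u v w)
    zero_mul := by
      rintro ⟨u⟩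
      exact congrArg (mk h) (LinearMap.map_zero₂ 𝒱.star u)
    mul_zero := by
      rintro ⟨u⟩
      exact congrArg (mk h) (map_zero (𝒱.star u))
    mul_assoc := by
      rintro ⟨u⟩ ⟨v⟩ ⟨w⟩
      exact (Submodule.Quotient.eq _).2 (h.assoc u v w)
    one_mul := by
      rintro ⟨u⟩
      exact (Submodule.Quotient.eq _).2 (h.vac_star u)
    mul_one := by
      rintro ⟨u⟩
      exact (Submodule.Quotient.eq _).2 (h.star_vac u) }

instance : Algebra ℂ (𝒱.ZhuAlgebra h) :=
  letI := quotientModule h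
  Algebra.ofModule
    (by
      rintro a ⟨u⟩ ⟨v⟩
      exact congrArg (mk h) (LinearMap.map_smul₂ 𝒱.star a u v))
    (by
      rintro a ⟨u⟩ ⟨v⟩
      exact congrArg (mk h) (map_smul (𝒱.star u) a v))

theorem mk_star (u v : V) : mk h (𝒱.star u v) = mk h u * mk h v := rfl

theorem mk_vac : mk h 𝒱.vac = 1 := rfl

theorem mk_smul (a : ℂ) (u : V) : mk h (a • u) = a • mk h u := rfl

end ZhuAlgebra

end CGradedVertexAlgebra

end

/-! The quotient `V / O(V)` is squeezed from both sides.

Upper bound: `V = O(V) + ℂ𝟏` (`zhuO_sup_span_vac`). A vector `u` of nonintegral weight equals `u ∘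
𝟏`, so it lies in `O(V)`. In integral weight, a nonempty monomial in the generators has the form
`u_n v` with `n < 0` and `u` of nonintegral weight; it is the leading term of `(u_n 𝟏) ∘ v`, whose
other terms have smaller integral weight. Induction on the weight ends at the vacuum, because no
negative integral weights occur.

Lower bound: the zero modes `o(u)` kill `Ω(V)` for `u ∈ O(V)` (`zeroMode_circ_apply`), while `o(𝟏) =
id`. Since `V ≠ 0` is `Ω`-generated, some `w ≠ 0` lies in `Ω(V)`, so `𝟏 ∉ O(V)`.

Together these say that `O(V)` is exactly the annihilator of `w` under `o` (`mem_zhuO_iff`). The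
algebra laws then need no general Zhu theory: with `o(u * v) = o(u) o(v)` on `Ω(V)`, they can be
tested on `w`, where every `o(v)` acts by a scalar. -/

noncomputable section

/-! ### Modes, residues and the Jacobi identity. -/

namespace VertexAlgebra

variable {V : Type*} [AddCommGroup V] [Module ℂ V] (𝒱 : VertexAlgebra V)

/-- The mode `u_n` as a linear function of `u`. -/
def modeLinear (n : ℤ) : V →ₗ[ℂ] Module.End ℂ V where
  toFun u := 𝒱.mode u n
  map_add' u u' := LinearMap.ext fun v => 𝒱.mode_add_left u u' n v
  map_smul' a u := LinearMap.ext fun v => 𝒱.mode_smul_left a u n v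

@[simp]
theorem modeLinear_apply (n : ℤ) (u : V) : 𝒱.modeLinear n u = 𝒱.mode u n := rfl

theorem mode_vac (n : ℤ) (v : V) : 𝒱.mode 𝒱.vac n v = if n = -1 then v else 0 :=
  𝒱.vacuum n v

theorem mode_vac_right_of_nonneg (v : V) {n : ℤ} (hn : 0 ≤ n) : 𝒱.mode v n 𝒱.vac = 0 :=
  𝒱.creation_regular v n hn

theorem mode_neg_one_vac (v : V) : 𝒱.mode v (-1) 𝒱.vac = v := 𝒱.creation v

theorem residue_apply (c m : ℤ) (u v : V) :
    𝒱.residue c m u v = ∑ᶠ i : ℕ, Ring.choose c i • 𝒱.mode u (m + i) v := rfl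

theorem jacobi_mode (u v w : V) (l m n : ℤ) :
    ∑ᶠ i : ℕ, Ring.choose m i • 𝒱.mode (𝒱.mode u (l + i) v) (m + n - i) w =
      ∑ᶠ i : ℕ, ((-1 : ℤ) ^ i * Ring.choose l i) •
        (𝒱.mode u (m + l - i) (𝒱.mode v (n + i) w) -
          (-1 : ℂ) ^ l • 𝒱.mode v (n + l - i) (𝒱.mode u (m + i) w)) :=
  𝒱.jacobi u v w l m n

/-- `Res_z (1+z)^c z^{-1} Y(u,z)𝟏 = u`. -/
theorem residue_neg_one_vac (c : ℤ) (u : V) : 𝒱.residue c (-1) u 𝒱.vac = u := by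
  rw [residue_apply, finsum_eq_single _ 0]
  · simp [mode_neg_one_vac]
  · intro i hi
    rw [mode_vac_right_of_nonneg _ _ (by omega), smul_zero]

/-- `(u_l 𝟏)_{-1} v = u_l v` for `l < 0`. -/
theorem mode_mode_vac_neg_one (u v : V) {l : ℤ} (hl : l < 0) :
    𝒱.mode (𝒱.mode u l 𝒱.vac) (-1) v = 𝒱.mode u l v := by
  -- Exponent `0` leaves one term on the left. On the right, the modes of `𝟏` in the second family
  -- have index `-1 + l - i`, which is never `-1` as `l < 0`.
  have h := 𝒱.jacobi_mode u 𝒱.vac v l 0 (-1)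
  rw [finsum_eq_single _ 0, finsum_eq_single _ 0] at h
  · simpa [mode_vac, hl.ne] using h
  · intro i hi
    rw [mode_vac, mode_vac, if_neg (by omega), if_neg (by omega)]
    simp
  · intro i hi
    rw [Ring.choose_zero_pos ℤ (Nat.pos_of_ne_zero hi), zero_smul]

end VertexAlgebra

/-! ### Weight projections and the two products on homogeneous vectors. -/

namespace CGradedVertexAlgebra

open VertexAlgebra

variable {V : Type*} [AddCommGroup V] [Module ℂ V] (𝒱 : CGradedVertexAlgebra V)

/-- The projection onto the weight space `V_λ`, as an endomorphism of `V`. -/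
def weightProj (lam : ℂ) : V →ₗ[ℂ] V :=
  (𝒱.wt lam).subtype ∘ₗ DirectSum.component ℂ ℂ (fun i => 𝒱.wt i) lam ∘ₗ
    𝒱.weightEquiv.symm.toLinearMap

theorem weightEquiv_symm_of_mem {lam : ℂ} {v : V} (hv : v ∈ 𝒱.wt lam) :
    𝒱.weightEquiv.symm v = DirectSum.lof ℂ ℂ (fun i => 𝒱.wt i) lam ⟨v, hv⟩ := by
  rw [LinearEquiv.symm_apply_eq]
  simp [weightEquiv]

theorem weightProj_of_mem {lam : ℂ} {v : V} (hv : v ∈ 𝒱.wt lam) : 𝒱.weightProj lam v = v := by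
  simp [weightProj, 𝒱.weightEquiv_symm_of_mem hv, DirectSum.component.lof_self]

theorem weightProj_of_mem_ne {lam mu : ℂ} {v : V} (hv : v ∈ 𝒱.wt mu) (h : mu ≠ lam) :
    𝒱.weightProj lam v = 0 := by
  simp [weightProj, 𝒱.weightEquiv_symm_of_mem hv, DirectSum.component.of, h]

theorem iSup_wt : ⨆ lam, 𝒱.wt lam = ⊤ := 𝒱.isInternal.submodule_iSup_eq_top

/-- Induction on homogeneous vectors. -/
theorem homogeneous_induction {p : V → Prop} (v : V)
    (hom : ∀ lam, ∀ v ∈ 𝒱.wt lam, p v) (add : ∀ x y, p x → p y → p (x + y)) : p v :=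
  Submodule.iSup_induction 𝒱.wt (motive := p) (x := v) (𝒱.iSup_wt ▸ Submodule.mem_top)
    hom (hom 0 0 (zero_mem _)) add

theorem delta_intCast (n : ℤ) : delta (n : ℂ) = 1 := by simp [delta]

theorem delta_of_nonint {lam : ℂ} (h : ∀ n : ℤ, lam ≠ n) : delta lam = 0 := by
  simp [delta, sub_eq_zero, h]

theorem circ_of_nonint {lam : ℂ} (h : ∀ n : ℤ, lam ≠ n) {u : V} (hu : u ∈ 𝒱.wt lam) (v : V) :
    𝒱.circ u v = 𝒱.residue (⌈lam.re⌉ - 1) (-1) u v := by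
  rw [circ, 𝒱.extend_of_mem _ hu, delta_of_nonint h]
  simp

theorem circ_of_int {n : ℤ} {u : V} (hu : u ∈ 𝒱.wt n) (v : V) :
    𝒱.circ u v = 𝒱.residue n (-2) u v := by
  rw [circ, 𝒱.extend_of_mem _ hu, delta_intCast]
  simp

theorem star_of_nonint {lam : ℂ} (h : ∀ n : ℤ, lam ≠ n) {u : V} (hu : u ∈ 𝒱.wt lam) (v : V) :
    𝒱.star u v = 0 := by
  rw [star, 𝒱.extend_of_mem _ hu, delta_of_nonint h]
  simp

theorem star_of_int {n : ℤ} {u : V} (hu : u ∈ 𝒱.wt n) (v : V) :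
    𝒱.star u v = 𝒱.residue n (-1) u v := by
  rw [star, 𝒱.extend_of_mem _ hu, delta_intCast]
  simp

theorem circ_mem_zhuO (u v : V) : 𝒱.circ u v ∈ 𝒱.zhuO := Submodule.subset_span ⟨u, v, rfl⟩

/-- A homogeneous vector of nonintegral weight is `u ∘ 𝟏`, hence lies in `O(V)`. -/
theorem mem_zhuO_of_nonint {lam : ℂ} (h : ∀ n : ℤ, lam ≠ n) {u : V} (hu : u ∈ 𝒱.wt lam) :
    u ∈ 𝒱.zhuO := by
  have := 𝒱.circ_mem_zhuO u 𝒱.vac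
  rwa [𝒱.circ_of_nonint h hu, residue_neg_one_vac] at this

theorem vac_star (v : V) : 𝒱.star 𝒱.vac v = v := by
  have h0 : 𝒱.vac ∈ 𝒱.wt ((0 : ℤ) : ℂ) := by simpa using 𝒱.vac_mem
  rw [𝒱.star_of_int h0, residue_apply, finsum_eq_single _ 0]
  · simp [mode_vac]
  · intro i hi
    rw [Ring.choose_zero_pos ℤ (Nat.pos_of_ne_zero hi), zero_smul]

/-- Equality holds only in integral weight; in nonintegral weight the product is `0` and the error
`-u` is in `O(V)`. -/
theorem star_vac_sub_mem (u : V) : 𝒱.star u 𝒱.vac - u ∈ 𝒱.zhuO := by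
  induction u using 𝒱.homogeneous_induction with
  | hom lam u hu =>
    by_cases h : ∃ n : ℤ, lam = n
    · obtain ⟨n, rfl⟩ := h
      rw [𝒱.star_of_int hu, residue_neg_one_vac, sub_self]
      exact zero_mem _
    · push Not at h
      rw [𝒱.star_of_nonint h hu, zero_sub]
      exact neg_mem (𝒱.mem_zhuO_of_nonint h hu)
  | add x y hx hy =>
    rw [map_add, LinearMap.add_apply, add_sub_add_comm]
    exact add_mem hx hy

/-! ### The zero mode action on `Ω(V)` -/

/-- The zero mode `o(u)`, the linear extension of `u ↦ u_{|u|-1}` for `u` homogeneous of integral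
weight and `u ↦ 0` for `u` homogeneous of nonintegral weight. -/
def zeroMode : V →ₗ[ℂ] V →ₗ[ℂ] V :=
  𝒱.extend fun lam => delta lam • 𝒱.modeLinear (⌈lam.re⌉ - 1)

theorem zeroMode_of_nonint {lam : ℂ} (h : ∀ n : ℤ, lam ≠ n) {u : V} (hu : u ∈ 𝒱.wt lam) :
    𝒱.zeroMode u = 0 := by
  rw [zeroMode, 𝒱.extend_of_mem _ hu, delta_of_nonint h]
  simp

/-- The weight stays a complex number with an equation to `n`, because the weights supplied by
`mode_mem` are integers only up to such an equation. -/
theorem zeroMode_of_int {n : ℤ} {lam : ℂ} (h : lam = n) {u : V} (hu : u ∈ 𝒱.wt lam) :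
    𝒱.zeroMode u = 𝒱.mode u (n - 1) := by
  subst h
  rw [zeroMode, 𝒱.extend_of_mem _ hu, delta_intCast]
  simp

theorem zeroMode_vac (w : V) : 𝒱.zeroMode 𝒱.vac w = w := by
  rw [𝒱.zeroMode_of_int (n := 0) (by simp) 𝒱.vac_mem, mode_vac]
  simp

variable {𝒱} in
/-- On `Ω(V)`, the modes `u_n` with `n ≥ Re |u| - 1` vanish, except possibly `u_{|u|-1}`. -/
theorem mode_eq_zero_of_mem_Omega {w : V} (hw : w ∈ 𝒱.Omega) {lam : ℂ} {u : V}
    (hu : u ∈ 𝒱.wt lam) {n : ℤ} (h1 : (n : ℂ) ≠ lam - 1) (h2 : lam.re - 1 ≤ n) :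
    𝒱.mode u n w = 0 := by
  by_contra h
  rcases hw lam u n hu h with h | h
  · exact h1 h
  · linarith

variable {𝒱} in
theorem mode_eq_zero_of_mem_Omega_of_int {w : V} (hw : w ∈ 𝒱.Omega) {k : ℤ} {u : V}
    (hu : u ∈ 𝒱.wt k) {n : ℤ} (h : k ≤ n) : 𝒱.mode u n w = 0 := by
  refine mode_eq_zero_of_mem_Omega hw hu ?_ ?_
  · exact_mod_cast (by omega : n ≠ k - 1)
  · have : (k : ℝ) ≤ n := by exact_mod_cast h
    simp only [Complex.intCast_re]
    linarith

/-- If `u ∈ V_λ`, `v ∈ V_μ` and `λ + μ` is an integer, the zero mode of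
`Res_z (1+z)^c z^m Y(u,z)v` is the left side of the Jacobi identity. -/
theorem zeroMode_residue {lam mu : ℂ} {u v : V} (hu : u ∈ 𝒱.wt lam) (hv : v ∈ 𝒱.wt mu)
    {s : ℤ} (hs : mu + lam = s) (c m : ℤ) (w : V) :
    𝒱.zeroMode (𝒱.residue c m u v) w =
      ∑ᶠ i : ℕ, Ring.choose c i •
        𝒱.mode (𝒱.mode u (m + i) v) (c + (s - m - 2 - c) - i) w := by
  rw [residue_apply, ← LinearMap.flip_apply,
    map_finsum _ (𝒱.finite_support_residue c m u v)]
  refine finsum_congr fun i => ?_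
  rw [LinearMap.flip_apply, map_zsmul, LinearMap.smul_apply,
    𝒱.zeroMode_of_int (n := s - (m + i) - 1) _ (𝒱.mode_mem _ _ _ _ _ hu hv)]
  · congr 3
    ring
  · rw [hs]
    push_cast
    ring

/-- If `u ∈ V_λ`, `v ∈ V_μ` and `λ + μ` is not an integer, all residues have zero mode `0`. -/
theorem zeroMode_residue_of_nonint {lam mu : ℂ} {u v : V} (hu : u ∈ 𝒱.wt lam)
    (hv : v ∈ 𝒱.wt mu) (hs : ∀ s : ℤ, mu + lam ≠ s) (c m : ℤ) (w : V) :
    𝒱.zeroMode (𝒱.residue c m u v) w = 0 := by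
  rw [residue_apply, ← LinearMap.flip_apply,
    map_finsum _ (𝒱.finite_support_residue c m u v)]
  refine finsum_eq_zero_of_forall_eq_zero fun i => ?_
  rw [LinearMap.flip_apply, map_zsmul, LinearMap.smul_apply,
    𝒱.zeroMode_of_nonint _ (𝒱.mode_mem _ _ _ _ _ hu hv)]
  · simp
  · intro n hn
    refine hs (n + (m + i) + 1) ?_
    push_cast at hn ⊢
    linear_combination hn

-- The exponents in `∘` are chosen so that, after the Jacobi identity, the innermost mode acting on
-- `w` always has an index that `Ω(V)` annihilates.
variable {𝒱} in
theorem zeroMode_circ_apply {w : V} (hw : w ∈ 𝒱.Omega) (u v : V) :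
    𝒱.zeroMode (𝒱.circ u v) w = 0 := by
  induction u using 𝒱.homogeneous_induction with
  | add x y hx hy => simp [hx, hy]
  | hom lam u hu =>
  induction v using 𝒱.homogeneous_induction with
  | add x y hx hy => simp [hx, hy]
  | hom mu v hv =>
  by_cases hs : ∃ s : ℤ, mu + lam = s
  · obtain ⟨s, hs⟩ := hs
    by_cases h : ∃ n : ℤ, lam = n
    · obtain ⟨k, rfl⟩ := h
      obtain rfl : mu = ((s - k : ℤ) : ℂ) := by push_cast; linear_combination hs
      rw [𝒱.circ_of_int hu, 𝒱.zeroMode_residue hu hv hs, jacobi_mode]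
      -- The inner modes are `u_{|u|+i}` and `v_{|v|+i}`, just beyond the zero modes.
      refine finsum_eq_zero_of_forall_eq_zero fun i => ?_
      rw [mode_eq_zero_of_mem_Omega_of_int hw hu (by omega),
        mode_eq_zero_of_mem_Omega_of_int hw hv (by omega)]
      simp
    · push Not at h
      rw [𝒱.circ_of_nonint h hu, 𝒱.zeroMode_residue hu hv hs, jacobi_mode]
      refine finsum_eq_zero_of_forall_eq_zero fun i => ?_
      have hre : mu.re + lam.re = s := by simpa using congrArg Complex.re hs
      have hi : (0 : ℝ) ≤ i := i.cast_nonneg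
      -- The inner modes have indices `⌈Re λ⌉ - 1 + i` for `u` and `s - ⌈Re λ⌉ + i` for `v`. Both
      -- reach the bound `Re - 1`, and the exceptional index would make `λ` an integer.
      rw [mode_eq_zero_of_mem_Omega hw hu, mode_eq_zero_of_mem_Omega hw hv]
      · simp
      · intro e
        refine h (⌈lam.re⌉ - 1 - i) ?_
        push_cast at e ⊢
        linear_combination hs + e
      · push_cast
        linarith [Int.ceil_lt_add_one lam.re]
      · intro e
        refine h (⌈lam.re⌉ + i) ?_
        push_cast at e ⊢
        linear_combination -e
      · push_cast
        linarith [Int.le_ceil lam.re]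
  · push Not at hs
    rw [circ, 𝒱.extend_of_mem _ hu]
    exact 𝒱.zeroMode_residue_of_nonint hu hv hs _ _ _

variable {𝒱} in
/-- `o(a)` vanishes on `Ω(V)` for `a ∈ O(V)`. -/
theorem zeroMode_apply_of_mem_zhuO {w : V} (hw : w ∈ 𝒱.Omega) {a : V} (ha : a ∈ 𝒱.zhuO) :
    𝒱.zeroMode a w = 0 := by
  have : 𝒱.zhuO ≤ LinearMap.ker (𝒱.zeroMode.flip w) := by
    refine Submodule.span_le.2 ?_
    rintro _ ⟨u, v, rfl⟩
    exact zeroMode_circ_apply hw u v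
  exact this ha

variable {𝒱} in
/-- `o(u * v) = o(u) o(v)` on `Ω(V)`. -/
theorem zeroMode_star_apply {w : V} (hw : w ∈ 𝒱.Omega) (u v : V) :
    𝒱.zeroMode (𝒱.star u v) w = 𝒱.zeroMode u (𝒱.zeroMode v w) := by
  induction u using 𝒱.homogeneous_induction with
  | add x y hx hy => simp [hx, hy]
  | hom lam u hu =>
  induction v using 𝒱.homogeneous_induction with
  | add x y hx hy => simp [hx, hy]
  | hom mu v hv =>
  by_cases h : ∃ n : ℤ, lam = n
  · obtain ⟨k, rfl⟩ := h
    rw [𝒱.star_of_int hu]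
    by_cases h' : ∃ n : ℤ, mu = n
    · obtain ⟨k', rfl⟩ := h'
      -- The inner modes are now `u_{k+i}`, which vanish on `w`, and `v_{k'-1+i}`, which vanish
      -- except for `i = 0`. The surviving term is `u_{k-1} v_{k'-1} w`; whether `v_{k'-1} w` lies
      -- in `Ω(V)` plays no role.
      rw [𝒱.zeroMode_residue hu hv (s := k' + k) (by push_cast; ring), jacobi_mode,
        finsum_eq_single _ 0, 𝒱.zeroMode_of_int rfl hu, 𝒱.zeroMode_of_int rfl hv]
      · rw [mode_eq_zero_of_mem_Omega_of_int hw hu (n := k + (0 : ℕ)) (by simp)]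
        have e : k' + k - -1 - 2 - k + ((0 : ℕ) : ℤ) = k' - 1 := by push_cast; ring
        rw [e]
        simp [sub_eq_add_neg]
      · intro i hi
        rw [mode_eq_zero_of_mem_Omega_of_int hw hu (by omega),
          mode_eq_zero_of_mem_Omega_of_int hw hv (by omega)]
        simp
    · push Not at h'
      rw [𝒱.zeroMode_of_nonint h' hv, 𝒱.zeroMode_residue_of_nonint hu hv]
      · simp
      · intro s e
        refine h' (s - k) ?_
        push_cast
        linear_combination e
  · push Not at h
    rw [𝒱.star_of_nonint h hu, 𝒱.zeroMode_of_nonint h hu]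
    simp

variable {𝒱} in
theorem IsOmegaGenerated.exists_mem_Omega_ne_zero [Nontrivial V] (h : 𝒱.IsOmegaGenerated) :
    ∃ w ∈ 𝒱.Omega, w ≠ 0 := by
  by_contra! h0
  have hz : ∀ l : List (V × ℤ), 𝒱.applyModes l 0 = 0 := by
    intro l
    induction l with
    | nil => rfl
    | cons p l ih =>
      change 𝒱.mode p.1 p.2 (𝒱.applyModes l 0) = 0
      rw [ih, map_zero]
  have : (⊤ : Submodule ℂ V) ≤ ⊥ := by
    rw [← h, Submodule.span_le]
    rintro _ ⟨l, w, hw, rfl⟩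
    rw [h0 w hw, hz]
    exact zero_mem _
  exact bot_ne_top (le_antisymm bot_le this)

/-! ### Generation of `V` modulo `O(V)` by the vacuum -/

variable {𝒱} in
/-- If `V^0` is spanned by the `V_n` with `n ∈ ℕ`, there are no nonzero vectors of negative
integral weight. -/
theorem wt_eq_bot_of_neg (hV0 : 𝒱.fracPart 0 = ⨆ n : ℕ, 𝒱.wt n) {m : ℤ} (hm : m < 0) :
    𝒱.wt m = ⊥ := by
  rw [eq_bot_iff]
  intro x hx
  have h1 : x ∈ 𝒱.fracPart 0 := Submodule.subset_span ⟨m, hx, by simp⟩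
  rw [hV0] at h1
  have h2 : ⨆ n : ℕ, 𝒱.wt n ≤ LinearMap.ker (𝒱.weightProj m) := by
    refine iSup_le fun n y hy => 𝒱.weightProj_of_mem_ne hy ?_
    exact_mod_cast (by omega : (n : ℤ) ≠ m)
  rw [Submodule.mem_bot, ← 𝒱.weightProj_of_mem hx]
  exact h2 h1

/-- A monomial in modes of homogeneous vectors applied to the vacuum is homogeneous. -/
theorem exists_applyModes_vac_mem_wt (l : List (V × ℤ))
    (hl : ∀ p ∈ l, ∃ lam, p.1 ∈ 𝒱.wt lam) : ∃ mu, 𝒱.applyModes l 𝒱.vac ∈ 𝒱.wt mu := by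
  induction l with
  | nil => exact ⟨0, 𝒱.vac_mem⟩
  | cons p l ih =>
    obtain ⟨mu, hmu⟩ := ih fun q hq => hl q (List.mem_cons_of_mem _ hq)
    obtain ⟨lam, hlam⟩ := hl p List.mem_cons_self
    exact ⟨_, 𝒱.mode_mem lam mu p.2 _ _ hlam hmu⟩

variable {𝒱} in
/-- Let `T ⊇ O(V)` contain all vectors of integral weight less than `N`, and let `u ∈ V` be
homogeneous of nonintegral weight. Then `u_n v ∈ T` if `n < 0` and `u_n v` has weight `N`. -/
theorem mode_mem_of_forall_lt {T : Submodule ℂ V} (hT : 𝒱.zhuO ≤ T) {N : ℤ}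
    (hN : ∀ m < N, 𝒱.wt m ≤ T) {lam mu : ℂ} (hlam : ∀ n : ℤ, lam ≠ n) {u v : V}
    (hu : u ∈ 𝒱.wt lam) (hv : v ∈ 𝒱.wt mu) {n : ℤ} (hn : n < 0) (hwt : mu + lam - n - 1 = N) :
    𝒱.mode u n v ∈ T := by
  have hu' := 𝒱.mode_mem lam 0 n u 𝒱.vac hu 𝒱.vac_mem
  have hlam' : ∀ k : ℤ, 0 + lam - n - 1 ≠ k := by
    intro k e
    refine hlam (k + n + 1) ?_
    push_cast
    linear_combination e
  -- The `i`-th term of `(u_n 𝟏) ∘ v` has weight `N - i`, and the term `i = 0` is `(u_n 𝟏)_{-1} v =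
  -- u_n v`.
  have hc := hT (𝒱.circ_mem_zhuO (𝒱.mode u n 𝒱.vac) v)
  rw [𝒱.circ_of_nonint hlam' hu', residue_apply] at hc
  set f := fun i : ℕ => Ring.choose (⌈(0 + lam - n - 1).re⌉ - 1) i •
    𝒱.mode (𝒱.mode u n 𝒱.vac) (-1 + i) v with hf
  have hfin : (Function.support f).Finite := 𝒱.finite_support_residue _ _ _ _
  have h0 : f 0 = 𝒱.mode u n v := by
    simp [hf, mode_mode_vac_neg_one _ _ _ hn]
  have hpos : ∀ i, i ≠ 0 → f i ∈ T := by
    intro i hi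
    refine T.smul_of_tower_mem _ (hN (N - i) (by omega) ?_)
    convert 𝒱.mode_mem _ mu (-1 + i) _ v hu' hv using 2
    push_cast
    linear_combination -hwt
  rw [← h0]
  rw [finsum_eq_sum_of_support_subset (s := insert 0 hfin.toFinset) f (by simp)] at hc
  rw [← Finset.add_sum_erase _ f (Finset.mem_insert_self _ _)] at hc
  refine (T.add_mem_iff_left (T.sum_mem fun i hi => hpos i ?_)).1 hc
  exact Finset.ne_of_mem_erase hi

variable {𝒱} in
/-- If `V` is strongly generated by homogeneous vectors of nonintegral weight and has no vectors of
negative integral weight, then `V = O(V) + ℂ𝟏`. -/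
theorem zhuO_sup_span_vac {S : Set V} (hS : 𝒱.StronglyGenerates S)
    (hom : ∀ u ∈ S, ∃ lam, u ∈ 𝒱.wt lam ∧ ∀ n : ℤ, lam ≠ n)
    (hneg : ∀ m : ℤ, m < 0 → 𝒱.wt m = ⊥) :
    𝒱.zhuO ⊔ Submodule.span ℂ {𝒱.vac} = ⊤ := by
  set T := 𝒱.zhuO ⊔ Submodule.span ℂ {𝒱.vac}
  have hvac : 𝒱.vac ∈ T := Submodule.mem_sup_right (Submodule.mem_span_singleton_self _)
  have hnat : ∀ N : ℕ, 𝒱.wt ((N : ℤ) : ℂ) ≤ T := by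
    intro N
    induction N using Nat.strong_induction_on with
    | _ N ih =>
    have ih' : ∀ m < (N : ℤ), 𝒱.wt m ≤ T := by
      intro m hm
      rcases lt_or_ge m 0 with h | h
      · rw [hneg m h]
        exact bot_le
      · lift m to ℕ using h
        exact ih m (by omega)
    -- Spanning monomials are homogeneous, so projecting to weight `N` reduces the claim to
    -- monomials of weight `N`.
    have hproj : (⊤ : Submodule ℂ V) ≤ T.comap (𝒱.weightProj ((N : ℤ) : ℂ)) := by
      rw [← hS, Submodule.span_le]
      rintro _ ⟨l, hl, rfl⟩
      have hl' : ∀ p ∈ l, ∃ lam, p.1 ∈ 𝒱.wt lam := fun p hp =>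
        (hom p.1 (hl p hp).1).imp fun _ h => h.1
      obtain ⟨nu, hnu⟩ := 𝒱.exists_applyModes_vac_mem_wt l hl'
      change 𝒱.weightProj _ _ ∈ T
      by_cases e : nu = ((N : ℤ) : ℂ)
      swap
      · rw [𝒱.weightProj_of_mem_ne hnu e]
        exact zero_mem _
      rw [e] at hnu
      rw [𝒱.weightProj_of_mem hnu]
      cases l with
      | nil => exact hvac
      | cons p l =>
        obtain ⟨lam, hlam, hni⟩ := hom p.1 (hl p List.mem_cons_self).1
        obtain ⟨mu, hmu⟩ := 𝒱.exists_applyModes_vac_mem_wt l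
          fun q hq => hl' q (List.mem_cons_of_mem _ hq)
        have hx := 𝒱.mode_mem lam mu p.2 _ _ hlam hmu
        change 𝒱.mode p.1 p.2 (𝒱.applyModes l 𝒱.vac) ∈ 𝒱.wt _ at hnu
        change 𝒱.mode p.1 p.2 (𝒱.applyModes l 𝒱.vac) ∈ T
        -- The weight found for the tail need not match `N` if the monomial is zero; a mismatch
        -- forces it to be zero.
        by_cases e' : mu + lam - p.2 - 1 = ((N : ℤ) : ℂ)
        · exact mode_mem_of_forall_lt le_sup_left ih' hni hlam hmu
            (hl p List.mem_cons_self).2 e'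
        · rw [← 𝒱.weightProj_of_mem hnu, 𝒱.weightProj_of_mem_ne hx e']
          exact zero_mem _
    intro x hx
    rw [← 𝒱.weightProj_of_mem hx]
    exact hproj Submodule.mem_top
  rw [eq_top_iff, ← 𝒱.iSup_wt]
  refine iSup_le fun lam => ?_
  by_cases h : ∃ n : ℤ, lam = n
  · obtain ⟨m, rfl⟩ := h
    rcases lt_or_ge m 0 with h | h
    · rw [hneg m h]
      exact bot_le
    · lift m to ℕ using h
      exact hnat m
  · push Not at h
    exact fun x hx => Submodule.mem_sup_left (𝒱.mem_zhuO_of_nonint h hx)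

/-! ### The algebra laws from the action on one vector of `Ω(V)`. -/

variable {𝒱} in
theorem exists_sub_smul_vac_mem (htop : 𝒱.zhuO ⊔ Submodule.span ℂ {𝒱.vac} = ⊤) (u : V) :
    ∃ a : ℂ, u - a • 𝒱.vac ∈ 𝒱.zhuO := by
  have hu : u ∈ 𝒱.zhuO ⊔ Submodule.span ℂ {𝒱.vac} := htop ▸ Submodule.mem_top
  obtain ⟨o, ho, y, hy, rfl⟩ := Submodule.mem_sup.1 hu
  obtain ⟨a, rfl⟩ := Submodule.mem_span_singleton.1 hy
  exact ⟨a, by simpa using ho⟩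

variable {𝒱} in
/-- If `V = O(V) + ℂ𝟏`, then `O(V)` is the annihilator of any nonzero vector of `Ω(V)`. -/
theorem mem_zhuO_iff (htop : 𝒱.zhuO ⊔ Submodule.span ℂ {𝒱.vac} = ⊤) {w : V}
    (hw : w ∈ 𝒱.Omega) (hw0 : w ≠ 0) {u : V} : u ∈ 𝒱.zhuO ↔ 𝒱.zeroMode u w = 0 := by
  refine ⟨zeroMode_apply_of_mem_zhuO hw, fun h => ?_⟩
  obtain ⟨a, ha⟩ := exists_sub_smul_vac_mem htop u
  -- This reads `o(u)w - a w = 0`, so `o(u)w = 0` forces `a = 0`.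
  have h1 := zeroMode_apply_of_mem_zhuO hw ha
  rw [map_sub, map_smul, LinearMap.sub_apply, LinearMap.smul_apply, h, zeroMode_vac, zero_sub,
    neg_eq_zero, smul_eq_zero, or_iff_left hw0] at h1
  simpa [h1] using ha

-- Each law becomes an identity of zero modes on `w`. Multiplicativity is known only on `Ω(V)`, and
-- `o(v)w = a w` keeps the computation there.
variable {𝒱} in
theorem zhuLaws_of_sup_eq_top (htop : 𝒱.zhuO ⊔ Submodule.span ℂ {𝒱.vac} = ⊤) {w : V}
    (hw : w ∈ 𝒱.Omega) (hw0 : w ≠ 0) : 𝒱.ZhuLaws := by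
  have right : ∀ u v : V, v ∈ 𝒱.zhuO → 𝒱.star u v ∈ 𝒱.zhuO := by
    intro u v hv
    rw [mem_zhuO_iff htop hw hw0] at hv ⊢
    rw [zeroMode_star_apply hw, hv, map_zero]
  have act : ∀ v : V, ∃ a : ℂ, 𝒱.zeroMode v w = a • w := by
    intro v
    obtain ⟨a, ha⟩ := exists_sub_smul_vac_mem htop v
    refine ⟨a, ?_⟩
    have h1 := zeroMode_apply_of_mem_zhuO hw ha
    rwa [map_sub, map_smul, LinearMap.sub_apply, LinearMap.smul_apply, zeroMode_vac,
      sub_eq_zero] at h1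
  refine ⟨fun u v hu => ?_, right, fun x y z => ?_, fun u => ?_, 𝒱.star_vac_sub_mem⟩
  · rw [mem_zhuO_iff htop hw hw0] at hu ⊢
    obtain ⟨a, ha⟩ := act v
    rw [zeroMode_star_apply hw, ha, map_smul, hu, smul_zero]
  · rw [mem_zhuO_iff htop hw hw0, map_sub, LinearMap.sub_apply, sub_eq_zero]
    obtain ⟨a, ha⟩ := act z
    simp only [zeroMode_star_apply hw, ha, map_smul]
  · rw [vac_star, sub_self]
    exact zero_mem _

end CGradedVertexAlgebra

end

theorem theorem5p4 {V : Type*} [AddCommGroup V] [Module ℂ V] [Nontrivial V]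
    (𝒱 : CGradedVertexAlgebra V) (k : ℕ) (u : Fin k → V) (wtu : Fin k → ℂ)
    (hgen : 𝒱.IsFinitelyOmegaGeneratedRePos (Set.range u))
    (hu : ∀ j, u j ∈ 𝒱.wt (wtu j))
    (hnonint : ∀ j, ∀ n : ℤ, wtu j ≠ n)
    (hV0 : 𝒱.fracPart 0 = ⨆ n : ℕ, 𝒱.wt n) :
    ∃ h : 𝒱.ZhuLaws,
      Module.rank ℂ (𝒱.ZhuAlgebra h) = 1 ∧ Nonempty (𝒱.ZhuAlgebra h ≃ₐ[ℂ] ℂ) := by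
  have htop : 𝒱.zhuO ⊔ Submodule.span ℂ {𝒱.vac} = ⊤ :=
    CGradedVertexAlgebra.zhuO_sup_span_vac hgen.strongly_generates
      (by rintro _ ⟨j, rfl⟩; exact ⟨wtu j, hu j, hnonint j⟩)
      (fun m hm => CGradedVertexAlgebra.wt_eq_bot_of_neg hV0 hm)
  obtain ⟨w, hw, hw0⟩ := hgen.omega_generated.exists_mem_Omega_ne_zero
  have h := CGradedVertexAlgebra.zhuLaws_of_sup_eq_top htop hw hw0
  have hne : (1 : 𝒱.ZhuAlgebra h) ≠ 0 := by
    intro e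
    have hv : 𝒱.vac ∈ 𝒱.zhuO := (Submodule.Quotient.mk_eq_zero _).1 e
    rw [CGradedVertexAlgebra.mem_zhuO_iff htop hw hw0, CGradedVertexAlgebra.zeroMode_vac] at hv
    exact hw0 hv
  have : Nontrivial (𝒱.ZhuAlgebra h) := ⟨⟨1, 0, hne⟩⟩
  -- Injective since `ℂ` is a field and `1 ≠ 0` in the target; surjective since `V = O(V) + ℂ𝟏`.
  have hbij : Function.Bijective (Algebra.ofId ℂ (𝒱.ZhuAlgebra h)) := by
    refine ⟨(Algebra.ofId ℂ (𝒱.ZhuAlgebra h)).toRingHom.injective, ?_⟩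
    rintro ⟨v⟩
    obtain ⟨a, ha⟩ := CGradedVertexAlgebra.exists_sub_smul_vac_mem htop v
    refine ⟨a, ?_⟩
    rw [Algebra.ofId_apply, Algebra.algebraMap_eq_smul_one]
    exact ((Submodule.Quotient.eq 𝒱.zhuO).2 ha).symm
  let e := AlgEquiv.ofBijective _ hbij
  exact ⟨h, by simpa using e.toLinearEquiv.lift_rank_eq.symm, ⟨e.symm⟩⟩
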